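/- Let $K$ be a field and let $q\in K$ satisfy $q\neq 0$ and $[m]\neq 0$ for all integers $m\ge 1$, where $[m]=1+q+\cdots+q^{m-1}$ (for instance $q$ an indeterminate and $K=\mathbb{Q}(q)$ or $\mathbb{Q}(q,x)$, or a real number $q\neq 0,-1$). Write $[m]!=[1][2]\cdots[m]$ and $\begin{bmatrix} m\\ k\end{bmatrix}=\frac{[m]!}{[k]!\,[m-k]!}$ for $0\le k\le m$. Let $$a(n)=\frac{1}{[n+1]}\begin{bmatrix}2n\\ n\end{bmatrix}\frac{1+q}{1+q^{n+1}}\,\frac{1}{\prod_{j=1}^{n}(1+q^j)^2}\qquad(n\ge 0)$$ be the $q$-Catalan numbers of Andrews, and put $r(n,x)=\sum_{k=0}^{n}a(n-k)x^k$ and $d(n,x)=\det\bigl(r(i+j,x)\bigr)_{i,j=0}^{n}$. Let $F_m(x,b,s,q)$ be defined by $F_0=0$, $F_1=1$ and $$F_m(x,b,s,q)=xF_{m-1}(x,b,s,q)+\frac{q^{m-3}s}{(1-q^{m-2}b)(1-q^{m-1}b)}F_{m-2}(x,b,s,q)\qquad(m\ge 2).$$ Then for all $n\ge 0$ and all $x\in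 K$ one has $d(n,0)\neq 0$ and $$\frac{d(n,x^2)}{d(n,0)}=\frac{(-1)^n}{q^{n^2}}\prod_{j=2}^{2n+1}(1+q^j)\;F_{2n+1}(x,-q,-q,q)=\sum_{k=0}^{n}q^{k^2-n^2}(-1)^{n-k}\prod_{j=k+2}^{2n-k+1}(1+q^j)\begin{bmatrix}2n-k\\ k\end{bmatrix}x^{2n-2k}.$$ -/

import Mathlib

namespace AndrewsCatalan

/-- The `q`-number `[n] = 1 + q + ⋯ + q ^ (n - 1)`. -/
def qNum {K : Type*} [Field K] (q : K) (n : ℕ) : K :=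
  ∑ i ∈ Finset.range n, q ^ i

/-- The `q`-factorial `[n]! = [1] [2] ⋯ [n]`. -/
def qFact {K : Type*} [Field K] (q : K) (n : ℕ) : K :=
  ∏ j ∈ Finset.Icc 1 n, qNum q j

/-- The `q`-binomial coefficient `[n]! / ([k]! [n - k]!)`, which is `0` for `k > n`. -/
def qBinom {K : Type*} [Field K] (q : K) (n k : ℕ) : K :=
  if k ≤ n then qFact q n / (qFact q k * qFact q (n - k)) else 0

/-- The `q`-Catalan numbers of Andrews. -/
def andrewsCatalan {K : Type*} [Field K] (q : K) (n : ℕ) : K :=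
  1 / qNum q (n + 1) * qBinom q (2 * n) n * ((1 + q) / (1 + q ^ (n + 1))) *
    (1 / ∏ j ∈ Finset.Icc 1 n, (1 + q ^ j) ^ 2)

/-- `r(n, x) = ∑_{k = 0}^{n} a(n - k) x ^ k` for a sequence `a`. -/
def convPoly {K : Type*} [Field K] (a : ℕ → K) (n : ℕ) (x : K) : K :=
  ∑ k ∈ Finset.range (n + 1), a (n - k) * x ^ k

/-- The Hankel determinant `d(n, x) = det (r(i + j, x))`, `0 ≤ i, j ≤ n`. -/
def hankelDet {K : Type*} [Field K] (a : ℕ → K) (n : ℕ) (x : K) : K :=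
  Matrix.det (Matrix.of fun i j : Fin (n + 1) => convPoly a (i.val + j.val) x)

/-- The `(q, b)`-Fibonacci polynomials `F_n(x, b, s, q)`, with `F_0 = 0`, `F_1 = 1` and
`F_n = x F_{n-1} + q ^ (n-3) s / ((1 - q ^ (n-2) b) (1 - q ^ (n-1) b)) F_{n-2}` for `n ≥ 2`.
The step `n = 2` is written separately: there the second term vanishes because `F_0 = 0`. -/
def qbFib {K : Type*} [Field K] (x b s q : K) : ℕ → K
  | 0 => 0
  | 1 => 1
  | 2 => x
  | m + 3 => x * qbFib x b s q (m + 2) +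
      q ^ m * s / ((1 - q ^ (m + 1) * b) * (1 - q ^ (m + 2) * b)) * qbFib x b s q (m + 1)

end AndrewsCatalan

open Polynomial Finset

namespace AndrewsCatalan

variable {K : Type*} [Field K]

/-! Let `L` send `X ^ n` to `a(n)`. With `X = t ^ 2` it belongs to monic orthogonal polynomials
`p_{k+2} = t p_{k+1} - T_k p_k`, where `T_k` is `stieltjesCoeff q k`; the closed form `qBallot` for
the values on `t ^ (2m+k) p_k` proves this. Put `p_{2r+1}(t) = t O_r(t ^ 2)`. Column operations
leave `r(i, y)` in column 0 of the Hankel matrix and `a(i + j)` elsewhere. Combining rows by the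
coefficients of the `O_r` makes the last row zero outside column 0 and the complementary minor
triangular, with diagonal independent of `y` (`hankelDet_eq_of_monic_orthogonal`). The surviving
entry is the functional with moments `r(i, y)` at `O_n`, i.e. `L` of the divided difference of `X
O_n(X)` at `y`. For `y = x ^ 2` this numerator polynomial is `F_{2n+1}(x)`
(`momentFunctional_convPoly_evenOddPoly`), so the quotient is `F_{2n+1}(x) / F_{2n+1}(0)`. A
`q`-Pascal rule gives the explicit sum. -/

/-- The product `(1 + q) (1 + q ^ 2) ⋯ (1 + q ^ n)`. -/
def onePlusProd (q : K) (n : ℕ) : K :=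
  ∏ j ∈ Icc 1 n, (1 + q ^ j)

/-- The coefficients of the Stieltjes continued fraction of Andrews' `q`-Catalan numbers. -/
def stieltjesCoeff (q : K) (k : ℕ) : K :=
  q ^ k / ((1 + q ^ (k + 1)) * (1 + q ^ (k + 2)))

/-! ### Arithmetic of `q`-numbers -/

theorem qNum_zero (q : K) : qNum q 0 = 0 := by simp [qNum]

theorem qNum_one (q : K) : qNum q 1 = 1 := by simp [qNum]

theorem qNum_add (q : K) (m n : ℕ) : qNum q (m + n) = qNum q m + q ^ m * qNum q n := by
  simp only [qNum, sum_range_add, mul_sum, pow_add]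

theorem pow_eq_one_add_qNum (q : K) (n : ℕ) : q ^ n = 1 + (q - 1) * qNum q n := by
  have := geom_sum_mul q n
  simp only [qNum]
  linear_combination -this

theorem qNum_two_mul (q : K) (n : ℕ) : qNum q (2 * n) = qNum q n * (1 + q ^ n) := by
  rw [two_mul, qNum_add]; ring

theorem qFact_zero (q : K) : qFact q 0 = 1 := by simp [qFact]

theorem qFact_succ (q : K) (n : ℕ) : qFact q (n + 1) = qFact q n * qNum q (n + 1) :=
  prod_Icc_succ_top (by omega) _

theorem onePlusProd_zero (q : K) : onePlusProd q 0 = 1 := by simp [onePlusProd]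

theorem onePlusProd_succ (q : K) (n : ℕ) :
    onePlusProd q (n + 1) = onePlusProd q n * (1 + q ^ (n + 1)) :=
  prod_Icc_succ_top (by omega) _

theorem one_add_pow_ne_zero {q : K} (hqn : ∀ m : ℕ, 1 ≤ m → qNum q m ≠ 0) {n : ℕ} (hn : 1 ≤ n) :
    1 + q ^ n ≠ 0 := by
  have h := hqn (2 * n) (by omega)
  rw [qNum_two_mul] at h
  exact right_ne_zero_of_mul h

theorem qFact_ne_zero {q : K} (hqn : ∀ m : ℕ, 1 ≤ m → qNum q m ≠ 0) (n : ℕ) : qFact q n ≠ 0 :=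
  prod_ne_zero_iff.2 fun j hj => hqn j (mem_Icc.1 hj).1

theorem onePlusProd_ne_zero {q : K} (hqn : ∀ m : ℕ, 1 ≤ m → qNum q m ≠ 0) (n : ℕ) :
    onePlusProd q n ≠ 0 :=
  prod_ne_zero_iff.2 fun _ hj => one_add_pow_ne_zero hqn (mem_Icc.1 hj).1

/-! ### Ballot numbers and their recurrence -/

/-- The `q`-ballot numbers: the value of the moment functional on `t ^ (2 m + k) p_k(t)`, where the
`p_k` are the orthogonal polynomials belonging to the Stieltjes continued fraction. -/
def qBallot (q : K) (m k : ℕ) : K :=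
  q ^ (k.choose 2) * (1 + q) * qNum q (k + 1) * qFact q (2 * m + k) /
    (onePlusProd q k * qFact q m * qFact q (m + k + 1) * onePlusProd q m *
      onePlusProd q (m + k + 1))

theorem choose_two_succ (k : ℕ) : (k + 1).choose 2 = k + k.choose 2 := by
  rw [Nat.choose_succ_succ' k 1, Nat.choose_one_right]

theorem qBallot_zero_succ {q : K} (hqn : ∀ m : ℕ, 1 ≤ m → qNum q m ≠ 0) (k : ℕ) :
    qBallot q 0 (k + 1) = stieltjesCoeff q k * qBallot q 0 k := by
  have h1 := onePlusProd_ne_zero hqn k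
  have h2 := qFact_ne_zero hqn k
  have h3 := one_add_pow_ne_zero hqn (show 1 ≤ k + 1 by omega)
  have h4 := one_add_pow_ne_zero hqn (show 1 ≤ k + 2 by omega)
  have h5 := hqn (k + 1) (by omega)
  have h6 := hqn (k + 2) (by omega)
  rw [qBallot, qBallot, stieltjesCoeff, mul_zero, zero_add, zero_add, qFact_zero,
    onePlusProd_zero, onePlusProd_succ q (k + 1), onePlusProd_succ q k, qFact_succ q (k + 1),
    qFact_succ q k, choose_two_succ, show k + 1 + 1 = k + 2 from rfl, pow_add q k (k.choose 2)]
  field_simp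

/-- What remains of the ballot recurrence once factorials cancel. Eliminating powers by `q ^ k = 1 +
(q - 1) [k]` makes it polynomial in `q`, `[k]`, `[m]`, so `q = 1` needs no separate case. -/
theorem qNum_ballot_identity (q : K) (m k : ℕ) :
    qNum q (2 * (k + 2)) * qNum q (2 * m + k + 3) =
      q ^ (k + 1) * qNum q (k + 3) * qNum q (2 * (m + 1)) +
        qNum q (k + 1) * qNum q (2 * (m + k + 3)) := by
  rw [show 2 * (k + 2) = k + k + 1 + 1 + 1 + 1 by ring,
    show 2 * m + k + 3 = m + m + k + 1 + 1 + 1 by ring, show k + 3 = k + 1 + 1 + 1 by ring,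
    show 2 * (m + 1) = m + m + 1 + 1 by ring,
    show 2 * (m + k + 3) = m + m + k + k + 1 + 1 + 1 + 1 + 1 + 1 by ring]
  simp only [qNum_add, pow_add, pow_eq_one_add_qNum q k, pow_eq_one_add_qNum q m, qNum_one, pow_one]
  ring

/-- This is `p_{k+2} = t p_{k+1} - T_k p_k` multiplied by `t ^ (2m+k+2)`, under the functional. -/
theorem qBallot_succ_succ {q : K} (hqn : ∀ m : ℕ, 1 ≤ m → qNum q m ≠ 0) (m k : ℕ) :
    qBallot q (m + 1) (k + 1) = qBallot q m (k + 2) + stieltjesCoeff q k * qBallot q (m + 1) k := by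
  have h1 := onePlusProd_ne_zero hqn k
  have h2 := onePlusProd_ne_zero hqn m
  have h3 := one_add_pow_ne_zero hqn (show 1 ≤ k + 1 by omega)
  have h4 := one_add_pow_ne_zero hqn (show 1 ≤ k + 2 by omega)
  have h5 := qFact_ne_zero hqn m
  have h6 := hqn (m + 1) (by omega)
  have h7 := one_add_pow_ne_zero hqn (show 1 ≤ m + 1 by omega)
  have h8 := one_add_pow_ne_zero hqn (show 1 ≤ m + k + 3 by omega)
  have h9 := hqn (m + k + 3) (by omega)
  have h10 := qFact_ne_zero hqn (m + k + 2)
  have h11 := onePlusProd_ne_zero hqn (m + k + 2)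
  have key := qNum_ballot_identity q m k
  simp only [qNum_two_mul] at key
  rw [qBallot, qBallot, qBallot, stieltjesCoeff, show 2 * (m + 1) + (k + 1) = 2 * m + k + 2 + 1 by ring,
    show 2 * m + (k + 2) = 2 * m + k + 2 by ring, show 2 * (m + 1) + k = 2 * m + k + 2 by ring,
    show m + 1 + (k + 1) + 1 = m + k + 2 + 1 by ring, show m + (k + 2) + 1 = m + k + 2 + 1 by ring,
    show m + 1 + k + 1 = m + k + 2 by ring, show k + 2 + 1 = k + 3 by ring,
    qFact_succ q (2 * m + k + 2), qFact_succ q (m + k + 2), onePlusProd_succ q (m + k + 2),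
    qFact_succ q m, onePlusProd_succ q m, onePlusProd_succ q (k + 1), onePlusProd_succ q k,
    choose_two_succ (k + 1), choose_two_succ k, show k + 1 + 1 = k + 2 by ring,
    show m + k + 2 + 1 = m + k + 3 by ring, show 2 * m + k + 2 + 1 = 2 * m + k + 3 by ring,
    pow_add q (k + 1), pow_add q k (k.choose 2)]
  field_simp
  linear_combination q ^ k * q ^ (k.choose 2) * qFact q (2 * m + k + 2) * (1 + q) * key

theorem andrewsCatalan_eq_qBallot {q : K} (hqn : ∀ m : ℕ, 1 ≤ m → qNum q m ≠ 0) (n : ℕ) :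
    andrewsCatalan q n = qBallot q n 0 := by
  have h1 := onePlusProd_ne_zero hqn n
  have h2 := qFact_ne_zero hqn n
  have h3 := one_add_pow_ne_zero hqn (show 1 ≤ n + 1 by omega)
  have h4 := hqn (n + 1) (by omega)
  rw [andrewsCatalan, qBinom, if_pos (by omega), show 2 * n - n = n by omega, prod_pow,
    show ∏ j ∈ Icc 1 n, (1 + q ^ j) = onePlusProd q n from rfl, qBallot]
  simp only [add_zero, zero_add, qNum_one, qFact_succ, onePlusProd_succ, onePlusProd_zero,
    Nat.choose_zero_succ, pow_zero]
  field_simp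

theorem andrewsCatalan_succ_eq_qBallot {q : K} (hqn : ∀ m : ℕ, 1 ≤ m → qNum q m ≠ 0) (n : ℕ) :
    andrewsCatalan q (n + 1) = qBallot q n 1 := by
  have h1 := onePlusProd_ne_zero hqn n
  have h2 := qFact_ne_zero hqn n
  have h3 := one_add_pow_ne_zero hqn (show 1 ≤ n + 1 by omega)
  have h4 := hqn (n + 1) (by omega)
  have h5 := one_add_pow_ne_zero hqn (show 1 ≤ n + 2 by omega)
  have h6 := hqn (n + 2) (by omega)
  have h7 := one_add_pow_ne_zero hqn le_rfl
  have h8 := qNum_two_mul q 1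
  have h9 := qNum_two_mul q (n + 1)
  rw [andrewsCatalan_eq_qBallot hqn, qBallot, qBallot, show 2 * (n + 1) + 0 = 2 * n + 1 + 1 by ring,
    qFact_succ q (2 * n + 1), show 2 * n + 1 + 1 = 2 * (n + 1) by ring, h9,
    show 1 + 1 = 2 * 1 by ring, h8]
  simp only [add_zero, zero_add, qNum_one, qFact_succ, onePlusProd_succ, onePlusProd_zero,
    Nat.choose_zero_succ, pow_zero, pow_one, add_assoc, one_add_one_eq_two, mul_one] at *
  rw [show Nat.choose 1 2 = 0 from rfl]
  field_simp

/-! ### Moment functional and orthogonality -/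

/-- The linear functional on polynomials that sends `X ^ n` to `u n`. -/
noncomputable def momentFunctional (u : ℕ → K) : K[X] →ₗ[K] K :=
  Polynomial.lsum fun n => u n • LinearMap.id

theorem momentFunctional_X_pow (u : ℕ → K) (n : ℕ) : momentFunctional u (X ^ n) = u n := by
  rw [momentFunctional, lsum_apply, X_pow_eq_monomial, sum_monomial_index] <;> simp

theorem momentFunctional_eq_sum (u : ℕ → K) {p : K[X]} {N : ℕ} (hp : p.natDegree < N) :
    momentFunctional u p = ∑ i ∈ range N, p.coeff i * u i := by
  rw [momentFunctional, lsum_apply, sum_over_range' _ _ _ hp]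
  · simp [mul_comm]
  · simp

theorem momentFunctional_X_pow_mul (u : ℕ → K) (j : ℕ) (p : K[X]) :
    momentFunctional u (X ^ j * p) = momentFunctional (fun i => u (i + j)) p := by
  induction p using Polynomial.induction_on' with
  | add p r hp hr => rw [mul_add, map_add, map_add, hp, hr]
  | monomial n c =>
    rw [← C_mul_X_pow_eq_monomial, ← smul_eq_C_mul, mul_smul_comm, map_smul, map_smul, ← pow_add,
      momentFunctional_X_pow, momentFunctional_X_pow, add_comm]

/-- The even and odd parts `(E_r, O_r)` of the orthogonal polynomials, `p_{2r}(t) = E_r(t ^ 2)` and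
`p_{2r+1}(t) = t O_r(t ^ 2)`, where `p_{m+2}(t) = t p_{m+1}(t) - T m * p_m(t)`. -/
noncomputable def evenOddPoly (T : ℕ → K) : ℕ → K[X] × K[X]
  | 0 => (1, 1)
  | r + 1 =>
    let E := X * (evenOddPoly T r).2 - C (T (2 * r)) * (evenOddPoly T r).1
    (E, E - C (T (2 * r + 1)) * (evenOddPoly T r).2)

theorem evenOddPoly_succ_fst (T : ℕ → K) (r : ℕ) : (evenOddPoly T (r + 1)).1 =
    X * (evenOddPoly T r).2 - C (T (2 * r)) * (evenOddPoly T r).1 := rfl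

theorem evenOddPoly_succ_snd (T : ℕ → K) (r : ℕ) : (evenOddPoly T (r + 1)).2 =
    (evenOddPoly T (r + 1)).1 - C (T (2 * r + 1)) * (evenOddPoly T r).2 := rfl

theorem evenOddPoly_monic_natDegree (T : ℕ → K) (r : ℕ) :
    ((evenOddPoly T r).1.natDegree ≤ r ∧ (evenOddPoly T r).1.coeff r = 1) ∧
      ((evenOddPoly T r).2.natDegree ≤ r ∧ (evenOddPoly T r).2.coeff r = 1) := by
  induction r with
  | zero => simp [evenOddPoly]
  | succ r ih =>
    obtain ⟨⟨hE, -⟩, hO, hO'⟩ := ih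
    have h1 : (evenOddPoly T (r + 1)).1.natDegree ≤ r + 1 := by
      rw [evenOddPoly_succ_fst]
      refine (natDegree_sub_le _ _).trans (max_le ?_ ?_)
      · exact natDegree_mul_le.trans (by rw [natDegree_X]; omega)
      · exact (natDegree_C_mul_le _ _).trans (by omega)
    have h2 : (evenOddPoly T (r + 1)).1.coeff (r + 1) = 1 := by
      rw [evenOddPoly_succ_fst, coeff_sub, coeff_X_mul, hO', coeff_C_mul,
        coeff_eq_zero_of_natDegree_lt (by omega), mul_zero, sub_zero]
    refine ⟨⟨h1, h2⟩, ?_, ?_⟩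
    · rw [evenOddPoly_succ_snd]
      exact (natDegree_sub_le _ _).trans (max_le h1 ((natDegree_C_mul_le _ _).trans (by omega)))
    · rw [evenOddPoly_succ_snd, coeff_sub, h2, coeff_C_mul,
        coeff_eq_zero_of_natDegree_lt (by omega), mul_zero, sub_zero]

theorem momentFunctional_sub_C_mul (u : ℕ → K) (n : ℕ) (p r : K[X]) (c : K) :
    momentFunctional u (X ^ n * (p - C c * r)) =
      momentFunctional u (X ^ n * p) - c * momentFunctional u (X ^ n * r) := by
  rw [mul_sub, map_sub, ← smul_eq_C_mul, mul_smul_comm, map_smul, smul_eq_mul]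

/-- Induction along the three-term recurrence. Each new vanishing moment is a boundary case, where
`qBallot_zero_succ` makes the two terms cancel. -/
theorem momentFunctional_evenOddPoly {q : K} (hqn : ∀ m : ℕ, 1 ≤ m → qNum q m ≠ 0) (r : ℕ) :
    ((∀ m, momentFunctional (andrewsCatalan q)
          (X ^ (m + r) * (evenOddPoly (stieltjesCoeff q) r).1) = qBallot q m (2 * r)) ∧
      ∀ n < r, momentFunctional (andrewsCatalan q)
          (X ^ n * (evenOddPoly (stieltjesCoeff q) r).1) = 0) ∧
    ((∀ m, momentFunctional (andrewsCatalan q)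
          (X ^ (m + r + 1) * (evenOddPoly (stieltjesCoeff q) r).2) = qBallot q m (2 * r + 1)) ∧
      ∀ n < r, momentFunctional (andrewsCatalan q)
          (X ^ (n + 1) * (evenOddPoly (stieltjesCoeff q) r).2) = 0) := by
  induction r with
  | zero =>
    simp [evenOddPoly, momentFunctional_X_pow, andrewsCatalan_succ_eq_qBallot hqn,
      andrewsCatalan_eq_qBallot hqn]
  | succ r ih =>
    obtain ⟨⟨hE, hE'⟩, hO, hO'⟩ := ih
    have hX (n : ℕ) : X ^ n * (X * (evenOddPoly (stieltjesCoeff q) r).2) =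
        X ^ (n + 1) * (evenOddPoly (stieltjesCoeff q) r).2 := by ring
    have h1 (m : ℕ) : momentFunctional (andrewsCatalan q)
        (X ^ (m + (r + 1)) * (evenOddPoly (stieltjesCoeff q) (r + 1)).1) =
          qBallot q m (2 * (r + 1)) := by
      rw [evenOddPoly_succ_fst, momentFunctional_sub_C_mul, hX,
        show m + (r + 1) = m + 1 + r by ring, hO, hE, qBallot_succ_succ hqn]
      rw [show 2 * (r + 1) = 2 * r + 2 by ring]; ring
    refine ⟨⟨h1, fun n hn => ?_⟩, fun m => ?_, fun n hn => ?_⟩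
    · rw [evenOddPoly_succ_fst, momentFunctional_sub_C_mul, hX]
      rcases Nat.lt_succ_iff_lt_or_eq.1 hn with h | rfl
      · rw [hO' n h, hE' n h]; ring
      · have h2 := hO 0
        have h3 := hE 0
        rw [zero_add] at h2 h3
        rw [h2, h3, qBallot_zero_succ hqn]; ring
    · rw [evenOddPoly_succ_snd, momentFunctional_sub_C_mul,
        show m + (r + 1) + 1 = m + 1 + (r + 1) by ring, h1, show m + 1 + (r + 1) = m + 1 + r + 1 by ring,
        hO, show 2 * (r + 1) = 2 * r + 1 + 1 by ring, qBallot_succ_succ hqn]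
      ring
    · rw [evenOddPoly_succ_snd, momentFunctional_sub_C_mul]
      rcases Nat.lt_succ_iff_lt_or_eq.1 hn with h | rfl
      · rw [hO' n h, evenOddPoly_succ_fst, momentFunctional_sub_C_mul, hX]
        rcases Nat.lt_or_eq_of_le (Nat.succ_le_of_lt h) with h' | h'
        · rw [hO' _ h', hE' _ h']; ring
        · have h2 := hO 0
          have h3 := hE 0
          subst h'
          rw [zero_add] at h2 h3
          rw [h2, h3, qBallot_zero_succ hqn]; ring
      · have h2 := hO 0
        have h3 := h1 0
        rw [zero_add] at h2 h3
        rw [h2, h3, show 2 * (n + 1) = 2 * n + 1 + 1 by ring, qBallot_zero_succ hqn]; ring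

/-! ### The moments `r(n, x)` and the Hankel determinant -/

theorem qbFib_add_two (q x : K) (k : ℕ) : qbFib x (-q) (-q) q (k + 2) =
    x * qbFib x (-q) (-q) q (k + 1) - stieltjesCoeff q k * qbFib x (-q) (-q) q k := by
  cases k with
  | zero => simp [qbFib]
  | succ m =>
    rw [qbFib, stieltjesCoeff,
      show (1 - q ^ (m + 1) * -q) * (1 - q ^ (m + 2) * -q) =
        (1 + q ^ (m + 1 + 1)) * (1 + q ^ (m + 1 + 2)) by ring]
    ring

theorem convPoly_succ (a : ℕ → K) (n : ℕ) (x : K) :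
    convPoly a (n + 1) x = x * convPoly a n x + a (n + 1) := by
  rw [convPoly, sum_range_succ', convPoly, mul_sum]
  simp only [Nat.add_sub_add_right, pow_zero, mul_one, tsub_zero]
  congr 1
  exact sum_congr rfl fun k _ => by ring

theorem momentFunctional_convPoly_X_mul (a : ℕ → K) (x : K) (p : K[X]) :
    momentFunctional (fun n => convPoly a n x) (X * p) =
      x * momentFunctional (fun n => convPoly a n x) p + momentFunctional a (X * p) := by
  induction p using Polynomial.induction_on' with
  | add p r hp hr => rw [mul_add, map_add, map_add, map_add, hp, hr]; ring
  | monomial n c =>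
    rw [← C_mul_X_pow_eq_monomial, ← smul_eq_C_mul, mul_smul_comm, map_smul, map_smul, map_smul,
      ← pow_succ']
    simp only [momentFunctional_X_pow, convPoly_succ, smul_eq_mul]
    ring

theorem hankelDet_eq_of_monic_orthogonal (a : ℕ → K) (p : ℕ → K[X]) (hdeg : ∀ r, (p r).natDegree ≤ r)
    (hone : ∀ r, (p r).coeff r = 1)
    (horth : ∀ r, ∀ j < r, momentFunctional a (X ^ (j + 1) * p r) = 0) (n : ℕ) (y : K) :
    hankelDet a n y = (-1) ^ n * momentFunctional (fun i => convPoly a i y) (p n) *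
      ∏ i ∈ range n, momentFunctional a (X ^ (i + 1) * p i) := by
  let B : Matrix (Fin (n + 1)) (Fin (n + 1)) K := Matrix.of fun i j =>
    if j.val = 0 then convPoly a i y else a (i.val + j.val)
  let U : Matrix (Fin (n + 1)) (Fin (n + 1)) K := Matrix.of fun r i => (p r.val).coeff i.val
  -- Since `r(n+1, y) = y r(n, y) + a(n+1)`, subtract `y` times the preceding column from each later
  -- column.
  have hB : hankelDet a n y = B.det := by
    refine Matrix.det_eq_of_forall_col_eq_smul_add_pred (fun _ => y) (fun i => by simp [B])
      fun i j => ?_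
    simp only [B, Matrix.of_apply, Fin.val_succ, Fin.val_castSucc, Nat.add_one_ne_zero, if_false]
    rw [← add_assoc, convPoly_succ, add_comm]
  have hU : U.det = 1 := by
    rw [Matrix.det_of_isLowerTriangular]
    · exact prod_eq_one fun i _ => hone i
    · intro r i hri
      exact coeff_eq_zero_of_natDegree_lt ((hdeg r).trans_lt hri)
  have hC (r : Fin (n + 1)) (u : ℕ → K) :
      ∑ i : Fin (n + 1), (p r.val).coeff i.val * u i.val = momentFunctional u (p r.val) := by
    rw [momentFunctional_eq_sum u ((hdeg r).trans_lt r.is_lt),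
      Fin.sum_univ_eq_sum_range fun i => (p r.val).coeff i * u i]
  have hC0 (r : Fin (n + 1)) : (U * B) r 0 = momentFunctional (fun i => convPoly a i y) (p r) := by
    rw [← hC, Matrix.mul_apply]
    simp [U, B]
  have hC1 (r : Fin (n + 1)) (j : Fin n) :
      (U * B) r j.succ = momentFunctional a (X ^ (j.val + 1) * p r) := by
    rw [momentFunctional_X_pow_mul, ← hC, Matrix.mul_apply]
    simp [U, B]
  have hUB : B.det = (U * B).det := by rw [Matrix.det_mul, hU, one_mul]
  -- Expansion along the last row; its column-0 cofactor has sign `(-1) ^ n`.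
  rw [hB, hUB, Matrix.det_succ_row _ (Fin.last n),
    Fin.sum_univ_succ, sum_eq_zero, add_zero, hC0, Matrix.det_of_isUpperTriangular]
  · simp only [Fin.succAbove_last, Fin.zero_succAbove, Matrix.submatrix_apply, hC1, Fin.val_last,
      Fin.val_zero, add_zero, Fin.val_castSucc]
    rw [Fin.prod_univ_eq_prod_range fun i => momentFunctional a (X ^ (i + 1) * p i)]
  · intro r j hjr
    simp only [Fin.succAbove_last, Fin.zero_succAbove, Matrix.submatrix_apply, hC1]
    exact horth _ _ hjr
  · intro j _
    rw [hC1, Fin.val_last, horth n j j.is_lt]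
    ring

theorem momentFunctional_sub_C_mul' (u : ℕ → K) (p r : K[X]) (c : K) :
    momentFunctional u (p - C c * r) = momentFunctional u p - c * momentFunctional u r := by
  simpa using momentFunctional_sub_C_mul u 0 p r c

/-- Both sides obey the same recurrence. The correction `L(E_r)` vanishes for `r > 0` and supplies
the initial value 1 at `r = 0`. -/
theorem momentFunctional_convPoly_evenOddPoly {q : K} (hqn : ∀ m : ℕ, 1 ≤ m → qNum q m ≠ 0) (x : K)
    (r : ℕ) :
    momentFunctional (fun i => convPoly (andrewsCatalan q) i (x ^ 2))
        (evenOddPoly (stieltjesCoeff q) r).1 = x * qbFib x (-q) (-q) q (2 * r) +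
          momentFunctional (andrewsCatalan q) (evenOddPoly (stieltjesCoeff q) r).1 ∧
      momentFunctional (fun i => convPoly (andrewsCatalan q) i (x ^ 2))
        (evenOddPoly (stieltjesCoeff q) r).2 = qbFib x (-q) (-q) q (2 * r + 1) := by
  induction r with
  | zero =>
    have h : andrewsCatalan q 0 = 1 := by
      have h7 := one_add_pow_ne_zero hqn le_rfl
      rw [pow_one] at h7
      simp [andrewsCatalan, qBinom, qFact_zero, qNum_one, h7]
    have h1 (u : ℕ → K) : momentFunctional u 1 = u 0 := by
      rw [← momentFunctional_X_pow u 0, pow_zero]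
    simp [evenOddPoly, h1, convPoly, qbFib, h]
  | succ r ih =>
    obtain ⟨hE, hO⟩ := ih
    have h0 := (momentFunctional_evenOddPoly hqn (r + 1)).1.2 0 r.succ_pos
    rw [pow_zero, one_mul] at h0
    have h1 : momentFunctional (fun i => convPoly (andrewsCatalan q) i (x ^ 2))
        (evenOddPoly (stieltjesCoeff q) (r + 1)).1 = x * qbFib x (-q) (-q) q (2 * (r + 1)) +
          momentFunctional (andrewsCatalan q) (evenOddPoly (stieltjesCoeff q) (r + 1)).1 := by
      rw [evenOddPoly_succ_fst, momentFunctional_sub_C_mul', momentFunctional_sub_C_mul',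
        momentFunctional_convPoly_X_mul, hE, hO, show 2 * (r + 1) = 2 * r + 2 by ring, qbFib_add_two]
      ring
    refine ⟨h1, ?_⟩
    rw [evenOddPoly_succ_snd, momentFunctional_sub_C_mul', h1, h0, hO,
      show 2 * (r + 1) + 1 = 2 * r + 1 + 2 by ring, qbFib_add_two,
      show 2 * (r + 1) = 2 * r + 1 + 1 by ring]
    ring

theorem hankelDet_andrewsCatalan {q : K} (hqn : ∀ m : ℕ, 1 ≤ m → qNum q m ≠ 0) (n : ℕ) (x : K) :
    hankelDet (andrewsCatalan q) n (x ^ 2) = (-1) ^ n * qbFib x (-q) (-q) q (2 * n + 1) *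
      ∏ i ∈ range n, qBallot q 0 (2 * i + 1) := by
  rw [hankelDet_eq_of_monic_orthogonal _ (fun r => (evenOddPoly (stieltjesCoeff q) r).2)
    (fun r => (evenOddPoly_monic_natDegree _ r).2.1) (fun r => (evenOddPoly_monic_natDegree _ r).2.2)
    fun r => (momentFunctional_evenOddPoly hqn r).2.2,
    (momentFunctional_convPoly_evenOddPoly hqn x n).2]
  congr 1
  refine prod_congr rfl fun i _ => ?_
  simpa using (momentFunctional_evenOddPoly hqn i).2.1 0

theorem qBallot_zero_ne_zero {q : K} (hq : q ≠ 0) (hqn : ∀ m : ℕ, 1 ≤ m → qNum q m ≠ 0) (k : ℕ) :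
    qBallot q 0 k ≠ 0 := by
  have h := one_add_pow_ne_zero hqn le_rfl
  rw [pow_one] at h
  simp [qBallot, hq, h, qFact_ne_zero hqn, onePlusProd_ne_zero hqn, hqn]

/-- At `x = 0` the recurrence gives the product of the `-T_{2i+1}`, `i < n`; the exponents are the
odd numbers, summing to `n ^ 2`. -/
theorem qbFib_odd_zero_mul {q : K} (hqn : ∀ m : ℕ, 1 ≤ m → qNum q m ≠ 0) (n : ℕ) :
    qbFib 0 (-q) (-q) q (2 * n + 1) * ∏ j ∈ Icc 2 (2 * n + 1), (1 + q ^ j) =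
      (-1) ^ n * q ^ (n ^ 2) := by
  induction n with
  | zero => simp [qbFib]
  | succ n ih =>
    have h1 := one_add_pow_ne_zero hqn (show 1 ≤ 2 * n + 1 + 1 by omega)
    have h2 := one_add_pow_ne_zero hqn (show 1 ≤ 2 * n + 1 + 2 by omega)
    rw [show 2 * (n + 1) + 1 = 2 * n + 1 + 1 + 1 by ring, prod_Icc_succ_top (by omega),
      prod_Icc_succ_top (by omega), show 2 * n + 1 + 1 + 1 = 2 * n + 1 + 2 by ring, qbFib_add_two,
      stieltjesCoeff, zero_mul, zero_sub, show (n + 1) ^ 2 = n ^ 2 + (2 * n + 1) by ring, pow_add q (n ^ 2),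
      pow_succ (-1 : K) n]
    field_simp
    linear_combination -q ^ (2 * n + 1) * ih

/-! ### Explicit coefficients of the Fibonacci polynomials -/

theorem qNum_mul_qBinom {q : K} (hqn : ∀ m : ℕ, 1 ≤ m → qNum q m ≠ 0) (n k : ℕ) :
    qNum q (k + 1) * qBinom q (n + 1) (k + 1) = qNum q (n + 1) * qBinom q n k := by
  by_cases h : k ≤ n
  · have h1 := qFact_ne_zero hqn k
    have h2 := qFact_ne_zero hqn (n - k)
    have h3 := hqn (k + 1) (by omega)
    rw [qBinom, qBinom, if_pos h, if_pos (by omega), Nat.add_sub_add_right, qFact_succ, qFact_succ]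
    field_simp
  · rw [qBinom, qBinom, if_neg h, if_neg (by omega)]; ring

theorem qNum_sub_mul_qBinom {q : K} (hqn : ∀ m : ℕ, 1 ≤ m → qNum q m ≠ 0) {n k : ℕ} (h : k ≤ n) :
    qNum q (n - k) * qBinom q (n + 1) (k + 1) = qNum q (n + 1) * qBinom q n (k + 1) := by
  rcases h.eq_or_lt with rfl | h
  · rw [qBinom, qBinom, if_neg (by omega : ¬ k + 1 ≤ k), Nat.sub_self, qNum_zero]; ring
  · obtain ⟨d, rfl⟩ := Nat.exists_eq_add_of_lt h
    have h1 := qFact_ne_zero hqn (k + 1)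
    have h2 := qFact_ne_zero hqn d
    have h3 := hqn (d + 1) (by omega)
    rw [qBinom, qBinom, if_pos (by omega), if_pos (by omega),
      show k + d + 1 + 1 - (k + 1) = d + 1 by omega, show k + d + 1 - (k + 1) = d by omega,
      show k + d + 1 - k = d + 1 by omega, qFact_succ q (k + d + 1), qFact_succ q d]
    field_simp

theorem qBinom_eq_zero_of_lt (q : K) {n k : ℕ} (h : n < k) : qBinom q n k = 0 :=
  if_neg (by omega)

theorem qBinom_zero_right {q : K} (hqn : ∀ m : ℕ, 1 ≤ m → qNum q m ≠ 0) (n : ℕ) :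
    qBinom q n 0 = 1 := by
  rw [qBinom, if_pos n.zero_le, qFact_zero, tsub_zero, one_mul, div_self (qFact_ne_zero hqn n)]

/-- A `q`-Pascal rule: for `n ≥ k`, with `n = k + d`. -/
theorem qBinom_pascal {q : K} (hqn : ∀ m : ℕ, 1 ≤ m → qNum q m ≠ 0) (k d : ℕ) :
    qBinom q (k + d + 1) (k + 1) * (1 + q ^ (k + d + 2)) =
      qBinom q (k + d) (k + 1) * (1 + q ^ (2 * k + d + 3)) +
        q ^ d * (1 + q ^ (k + 2)) * qBinom q (k + d) k := by
  have h1 := qNum_mul_qBinom hqn (k + d) k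
  have h2 := qNum_sub_mul_qBinom hqn (Nat.le_add_right k d)
  rw [Nat.add_sub_cancel_left] at h2
  have h3 : qNum q (k + d + 1) * (1 + q ^ (k + d + 2)) = qNum q d * (1 + q ^ (2 * k + d + 3)) +
      q ^ d * (1 + q ^ (k + 2)) * qNum q (k + 1) := by
    simp only [two_mul, qNum_add, pow_add, pow_eq_one_add_qNum q k, pow_eq_one_add_qNum q d, qNum_one]
    ring
  -- After this multiplication `h1` and `h2` reduce every term to a multiple of `qBinom q (k + d +
  -- 1) (k + 1)`.
  refine mul_left_cancel₀ (hqn (k + d + 1) (by omega)) ?_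
  linear_combination qBinom q (k + d + 1) (k + 1) * h3 + (1 + q ^ (2 * k + d + 3)) * h2 +
    q ^ d * (1 + q ^ (k + 2)) * h1

/-- The coefficient of `x ^ (m - 2 k)` in `F_{m + 1}(x, -q, -q, q)`. -/
def qbFibCoeff (q : K) (m k : ℕ) : K :=
  (-1) ^ k * q ^ (k ^ 2) * qBinom q (m - k) k * ((1 + q) * onePlusProd q (m - k + 1)) /
    (onePlusProd q (k + 1) * onePlusProd q (m + 1))

theorem qbFibCoeff_zero_right {q : K} (hqn : ∀ m : ℕ, 1 ≤ m → qNum q m ≠ 0) (m : ℕ) :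
    qbFibCoeff q m 0 = 1 := by
  have h1 := one_add_pow_ne_zero hqn le_rfl
  have h2 := onePlusProd_ne_zero hqn (m + 1)
  rw [pow_one] at h1
  rw [qbFibCoeff, qBinom_zero_right hqn, onePlusProd_succ q 0, onePlusProd_zero]
  simp [h1, h2]

theorem qbFibCoeff_eq_zero (q : K) {m k : ℕ} (h : m < 2 * k) : qbFibCoeff q m k = 0 := by
  rw [qbFibCoeff, qBinom_eq_zero_of_lt q (by omega)]; simp

theorem qbFibCoeff_succ_succ {q : K} (hqn : ∀ m : ℕ, 1 ≤ m → qNum q m ≠ 0) (m k : ℕ) :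
    qbFibCoeff q (m + 2) (k + 1) =
      qbFibCoeff q (m + 1) (k + 1) - stieltjesCoeff q (m + 1) * qbFibCoeff q m k := by
  by_cases h : 2 * k ≤ m
  · obtain ⟨d, rfl⟩ := Nat.exists_eq_add_of_le h
    have h1 := onePlusProd_ne_zero hqn (k + 1)
    have h2 := onePlusProd_ne_zero hqn (2 * k + d + 1)
    have h3 := one_add_pow_ne_zero hqn (show 1 ≤ k + 2 by omega)
    have h4 := one_add_pow_ne_zero hqn (show 1 ≤ 2 * k + d + 2 by omega)
    have h5 := one_add_pow_ne_zero hqn (show 1 ≤ 2 * k + d + 3 by omega)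
    have key := qBinom_pascal hqn k d
    rw [qbFibCoeff, qbFibCoeff, qbFibCoeff, stieltjesCoeff,
      show 2 * k + d + 2 - (k + 1) = k + d + 1 by omega,
      show 2 * k + d + 1 - (k + 1) = k + d by omega, show 2 * k + d - k = k + d by omega,
      onePlusProd_succ q (2 * k + d + 2), onePlusProd_succ q (2 * k + d + 1),
      onePlusProd_succ q (k + d + 1), onePlusProd_succ q (k + 1),
      show k + 1 + 1 = k + 2 from rfl, show k + d + 1 + 1 = k + d + 2 from rfl,
      show 2 * k + d + 1 + 1 = 2 * k + d + 2 from rfl, show 2 * k + d + 2 + 1 = 2 * k + d + 3 from rfl,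
      show 2 * k + d + 1 + 2 = 2 * k + d + 3 from rfl,
      show (k + 1) ^ 2 = k ^ 2 + (2 * k + 1) by ring, show 2 * k + d + 1 = 2 * k + 1 + d by ring,
      pow_add q (k ^ 2), pow_add q (2 * k + 1) d, pow_succ (-1 : K) k]
    rw [show 2 * k + d + 1 = 2 * k + 1 + d by ring] at h2
    field_simp
    linear_combination -(q ^ (2 * k + 1) * q ^ (k ^ 2) * onePlusProd q (k + d + 1) * (1 + q)) * key
  · rw [qbFibCoeff_eq_zero q (by omega), qbFibCoeff_eq_zero q (by omega : m + 1 < 2 * (k + 1)),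
      qbFibCoeff_eq_zero q (by omega : m < 2 * k)]
    ring

theorem qbFib_eq_sum {q : K} (hqn : ∀ m : ℕ, 1 ≤ m → qNum q m ≠ 0) (x : K) (m : ℕ) :
    qbFib x (-q) (-q) q (m + 1) = ∑ k ∈ range (m + 1), qbFibCoeff q m k * x ^ (m - 2 * k) := by
  induction m using Nat.twoStepInduction with
  | zero => simp [qbFib, qbFibCoeff_zero_right hqn]
  | one => simp [qbFib, sum_range_succ, qbFibCoeff_zero_right hqn, qbFibCoeff_eq_zero]
  | more m h1 h2 =>
    rw [qbFib_add_two, h1, h2, sum_range_succ', sum_range_succ' _ (m + 2), mul_add, mul_sum,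
      sum_range_succ _ (m + 1), qbFibCoeff_eq_zero q (by omega : m + 2 < 2 * (m + 1 + 1)), mul_sum]
    simp only [qbFibCoeff_zero_right hqn, mul_zero, tsub_zero, zero_mul, add_zero, one_mul]
    rw [add_sub_right_comm, ← sum_sub_distrib]
    congr 1
    · refine sum_congr rfl fun k _ => ?_
      rw [qbFibCoeff_succ_succ hqn, show m + 2 - 2 * (k + 1) = m - 2 * k by omega]
      -- When the exponent `m + 1 - 2 * (k + 1)` truncates, its coefficient is zero.
      by_cases h : 2 * (k + 1) ≤ m + 1
      · rw [show m - 2 * k = m + 1 - 2 * (k + 1) + 1 by omega]; ring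
      · rw [qbFibCoeff_eq_zero q (by omega : m + 1 < 2 * (k + 1))]; ring
    · ring

theorem onePlusProd_mul_prod_Icc (q : K) {m n : ℕ} (h : m ≤ n) :
    onePlusProd q m * ∏ j ∈ Icc (m + 1) n, (1 + q ^ j) = onePlusProd q n := by
  induction n, h using Nat.le_induction with
  | base => simp
  | succ n h ih => rw [prod_Icc_succ_top (by omega), ← mul_assoc, ih, onePlusProd_succ]

theorem qbFibCoeff_mul_prod {q : K} (hq : q ≠ 0) (hqn : ∀ m : ℕ, 1 ≤ m → qNum q m ≠ 0) {n k : ℕ}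
    (h : k ≤ n) :
    (-1) ^ n / q ^ (n ^ 2) * (∏ j ∈ Icc 2 (2 * n + 1), (1 + q ^ j)) * qbFibCoeff q (2 * n) k =
      q ^ ((k : ℤ) ^ 2 - (n : ℤ) ^ 2) * (-1) ^ (n - k) *
        (∏ j ∈ Icc (k + 2) (2 * n - k + 1), (1 + q ^ j)) * qBinom q (2 * n - k) k := by
  have h1 := onePlusProd_mul_prod_Icc q (show 1 ≤ 2 * n + 1 by omega)
  have h2 := onePlusProd_mul_prod_Icc q (show k + 1 ≤ 2 * n - k + 1 by omega)
  have h3 := onePlusProd_ne_zero hqn (k + 1)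
  have h4 := onePlusProd_ne_zero hqn (2 * n + 1)
  have h5 : onePlusProd q 1 = 1 + q := by simp [onePlusProd]
  have h6 : (-1 : K) ^ n * (-1) ^ k = (-1) ^ (n - k) := by
    obtain ⟨d, rfl⟩ := Nat.exists_eq_add_of_le h
    rw [Nat.add_sub_cancel_left, pow_add, mul_right_comm, ← mul_pow]; simp
  rw [h5] at h1
  have h7 : q ^ ((k : ℤ) ^ 2 - (n : ℤ) ^ 2) = q ^ (k ^ 2) / q ^ (n ^ 2) := by
    rw [zpow_sub₀ hq]
    norm_cast
  rw [qbFibCoeff, ← h2, h7, ← h6, ← h1]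
  rw [← h1] at h4
  have h8 := left_ne_zero_of_mul h4
  have h9 := right_ne_zero_of_mul h4
  field_simp

end AndrewsCatalan

/-! ### The quotient of determinants -/

theorem corollary4 {K : Type*} [Field K] (q : K) (hq : q ≠ 0)
    (hqn : ∀ m : ℕ, 1 ≤ m → AndrewsCatalan.qNum q m ≠ 0) (n : ℕ) (x : K) :
    AndrewsCatalan.hankelDet (AndrewsCatalan.andrewsCatalan q) n 0 ≠ 0 ∧
    AndrewsCatalan.hankelDet (AndrewsCatalan.andrewsCatalan q) n (x ^ 2) /
        AndrewsCatalan.hankelDet (AndrewsCatalan.andrewsCatalan q) n 0 =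
      (-1) ^ n / q ^ (n ^ 2) * (∏ j ∈ Finset.Icc 2 (2 * n + 1), (1 + q ^ j)) *
        AndrewsCatalan.qbFib x (-q) (-q) q (2 * n + 1) ∧
    AndrewsCatalan.hankelDet (AndrewsCatalan.andrewsCatalan q) n (x ^ 2) /
        AndrewsCatalan.hankelDet (AndrewsCatalan.andrewsCatalan q) n 0 =
      ∑ k ∈ Finset.range (n + 1),
        q ^ ((k : ℤ) ^ 2 - (n : ℤ) ^ 2) * (-1) ^ (n - k) *
          (∏ j ∈ Finset.Icc (k + 2) (2 * n - k + 1), (1 + q ^ j)) *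
          AndrewsCatalan.qBinom q (2 * n - k) k * x ^ (2 * n - 2 * k) := by
  have hx := AndrewsCatalan.hankelDet_andrewsCatalan hqn n x
  have h0 := AndrewsCatalan.hankelDet_andrewsCatalan hqn n 0
  rw [zero_pow two_ne_zero] at h0
  have hF := AndrewsCatalan.qbFib_odd_zero_mul hqn n
  have hG : ∏ i ∈ range n, AndrewsCatalan.qBallot q 0 (2 * i + 1) ≠ 0 :=
    prod_ne_zero_iff.2 fun _ _ => AndrewsCatalan.qBallot_zero_ne_zero hq hqn _
  have hs : (-1 : K) ^ n ≠ 0 := pow_ne_zero _ (neg_ne_zero.2 one_ne_zero)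
  have hs2 : (-1 : K) ^ n * (-1) ^ n = 1 := by rw [← mul_pow]; simp
  have hqp : q ^ (n ^ 2) ≠ 0 := pow_ne_zero _ hq
  have hF0 : AndrewsCatalan.qbFib 0 (-q) (-q) q (2 * n + 1) ≠ 0 :=
    left_ne_zero_of_mul (hF ▸ mul_ne_zero hs hqp)
  have hd : AndrewsCatalan.hankelDet (AndrewsCatalan.andrewsCatalan q) n 0 ≠ 0 :=
    h0 ▸ mul_ne_zero (mul_ne_zero hs hF0) hG
  have h1 : AndrewsCatalan.hankelDet (AndrewsCatalan.andrewsCatalan q) n (x ^ 2) /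
        AndrewsCatalan.hankelDet (AndrewsCatalan.andrewsCatalan q) n 0 =
      (-1) ^ n / q ^ (n ^ 2) * (∏ j ∈ Icc 2 (2 * n + 1), (1 + q ^ j)) *
        AndrewsCatalan.qbFib x (-q) (-q) q (2 * n + 1) := by
    rw [div_eq_iff hd, hx, h0, div_mul_eq_mul_div, div_mul_eq_mul_div, div_mul_eq_mul_div, eq_div_iff hqp]
    linear_combination (-AndrewsCatalan.qbFib x (-q) (-q) q (2 * n + 1) *
      ∏ i ∈ range n, AndrewsCatalan.qBallot q 0 (2 * i + 1)) * ((-1) ^ n * (-1) ^ n * hF +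
        (-1) ^ n * q ^ (n ^ 2) * hs2)
  refine ⟨hd, h1, h1.trans ?_⟩
  -- The terms with `n < k ≤ 2n` have zero coefficient.
  rw [AndrewsCatalan.qbFib_eq_sum hqn, mul_sum,
    ← sum_subset (range_subset_range.2 (by omega : n + 1 ≤ 2 * n + 1))]
  · refine sum_congr rfl fun k hk => ?_
    rw [← mul_assoc, AndrewsCatalan.qbFibCoeff_mul_prod hq hqn (Nat.lt_succ_iff.1 (mem_range.1 hk))]
  · intro k _ hk
    rw [mem_range, not_lt] at hk
    rw [AndrewsCatalan.qbFibCoeff_eq_zero q (by omega)]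
    ring
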